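/- Let $q\ge 2$ and $n\ge 1$, and let $H(n,q)$ be the Hamming graph on the set $\{0,\dots,q-1\}^n$ (two words are adjacent if they differ in exactly one position), with the Hamming distance $d(\cdot,\cdot)$. A $1$-perfect code is a set $P$ of words such that every word is at distance at most $1$ from exactly one element of $P$; shortening $P$ with a symbol $\alpha$ in position $j$ means taking all words of $P$ that have $\alpha$ in position $j$ and deleting that position. A code $C\subseteq\{0,\dots,q-1\}^n$ is called shortened-$1$-perfect-like if its minimum distance is exactly $3$ and its length and size are those of a shortened $1$-perfect code, that is, either $$n=\frac{q^m-q}{q-1},\qquad |C|=q^{\,n-m}\qquad\text{for some integer } m\ge 2,$$ or there is a $1$-perfect code in $H(n+1,q)$ some shortened code of which has size $|C|$. (The alphabet size $q$ is arbitrary; for a prime power $q$ the first alternative covers all cases.) For a code $C$ let $C^{(i)}$ be the set of words at distance exactly $i$ from $C$. The code $C$ is completely regular if for all $i$ and $j$ the number of neighbours in $C^{(j)}$ is the same for all words of $C^{(i)}$. A code $C$ with minimum distance $2e+1$ or $2e+2$ is uniformly packed (in the sense of Goethals and van Tilborg) if its covering radius is $e+1$ and there are constants $\lambda,\mu$ such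 that every word of $C^{(e)}$ has exactly $\lambda$ codewords at distance $e+1$ and every word of $C^{(e+1)}$ has exactly $\mu$ codewords at distance $e+1$. Every shortened-$1$-perfect-like code is completely regular and uniformly packed. -/

import Mathlib

/-- Words of length `n` over an alphabet of size `q`; distances between words are measured by
Mathlib's `hammingDist`. -/
abbrev Word (n q : ℕ) : Type := Fin n → Fin q

/-- The Hamming graph `H(n,q)`: two words are adjacent if they differ in exactly one position. -/
def hammingGraph (n q : ℕ) : SimpleGraph (Word n q) where
  Adj x y := hammingDist x y = 1
  symm := ⟨fun x y h => by rw [hammingDist_comm]; exact h⟩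
  loopless := ⟨fun x h => by simp at h⟩

/-- The code `C` has minimum distance exactly `d` (in particular it has at least two words). -/
def HasMinDist {n q : ℕ} (C : Set (Word n q)) (d : ℕ) : Prop :=
  (∃ x ∈ C, ∃ y ∈ C, x ≠ y ∧ hammingDist x y = d) ∧
    ∀ x ∈ C, ∀ y ∈ C, x ≠ y → d ≤ hammingDist x y

/-- `C` is an `(n, M, d)_q`-code. -/
def IsCodeWith {n q : ℕ} (C : Set (Word n q)) (M d : ℕ) : Prop :=
  C.ncard = M ∧ HasMinDist C d

/-- The set `C^{(i)}` of words at distance exactly `i` from the code `C`. -/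
def distLayer {n q : ℕ} (C : Set (Word n q)) (i : ℕ) : Set (Word n q) :=
  {x | (∃ c ∈ C, hammingDist x c = i) ∧ ∀ c ∈ C, i ≤ hammingDist x c}

/-- Completely regular: the number of neighbours in `C^{(j)}` is the same for all words of
`C^{(i)}`. -/
def IsCompletelyRegular {n q : ℕ} (C : Set (Word n q)) : Prop :=
  ∀ i j : ℕ, ∃ k : ℕ, ∀ x ∈ distLayer C i,
    {y | (hammingGraph n q).Adj x y ∧ y ∈ distLayer C j}.ncard = k

/-- The number of codewords of `C` at distance `i` from `x`. -/
noncomputable def codewordsAt {n q : ℕ} (C : Set (Word n q)) (x : Word n q) (i : ℕ) : ℕ :=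
  {c | c ∈ C ∧ hammingDist x c = i}.ncard

/-- `C` has covering radius exactly `r`. -/
def HasCoveringRadius {n q : ℕ} (C : Set (Word n q)) (r : ℕ) : Prop :=
  (∀ x, ∃ c ∈ C, hammingDist x c ≤ r) ∧ (distLayer C r).Nonempty

/-- Uniformly packed in the sense of Goethals and van Tilborg: the minimum distance is `2e+1` or
`2e+2`, the covering radius is `e+1`, and the number of codewords at distance `e+1` from a word
is a constant `l` on the words at distance `e` from `C` and a constant `u` on the words
at distance `e+1` from `C`. -/
def IsUniformlyPacked {n q : ℕ} (C : Set (Word n q)) : Prop :=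
  ∃ e l u : ℕ, (HasMinDist C (2 * e + 1) ∨ HasMinDist C (2 * e + 2)) ∧
    HasCoveringRadius C (e + 1) ∧
    (∀ x ∈ distLayer C e, codewordsAt C x (e + 1) = l) ∧
    (∀ x ∈ distLayer C (e + 1), codewordsAt C x (e + 1) = u)

/-- A `1`-perfect code: every word is at distance at most `1` from exactly one codeword. -/
def IsOnePerfect {n q : ℕ} (P : Set (Word n q)) : Prop :=
  ∀ x, ∃! c, c ∈ P ∧ hammingDist x c ≤ 1

/-- The code `P` shortened with the symbol `a` in position `j`: take the codewords that have `a`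
in position `j` and delete that position. -/
def shorten {n q : ℕ} (P : Set (Word (n + 1) q)) (j : Fin (n + 1)) (a : Fin q) :
    Set (Word n q) :=
  {x | (j.insertNth a x : Word (n + 1) q) ∈ P}

/-- `(n, M)` are the length and the size of a `q`-ary shortened `1`-perfect code: either
`n = (q ^ m - q) / (q - 1)` and `M = q ^ (n - m)` for some `m ≥ 2` (the parameters of a
shortened Hamming code, written without subtraction and allowed for every alphabet size `q`),
or there is a `1`-perfect code in `H(n+1,q)` with a shortened code of size `M`. For a prime
power `q` and `n ≥ 1` the first alternative is the only one that occurs. -/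
def IsShortenedOnePerfectSize (n q M : ℕ) : Prop :=
  (∃ m : ℕ, 2 ≤ m ∧ n * (q - 1) + q = q ^ m ∧ M * q ^ m = q ^ n) ∨
    ∃ P : Set (Word (n + 1) q), IsOnePerfect P ∧
      ∃ (j : Fin (n + 1)) (a : Fin q), (shorten P j a).ncard = M

/-- Shortened-`1`-perfect-like codes: codes with the parameters (alphabet size, length, size,
minimum distance `3`) of shortened `1`-perfect codes. -/
def IsShortenedOnePerfectLike {n q : ℕ} (C : Set (Word n q)) : Prop :=
  ∃ M : ℕ, IsShortenedOnePerfectSize n q M ∧ IsCodeWith C M 3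

/-! Let `A` be the adjacency operator of `H(n,q)`, `l = n(q-1)`, and `f` the indicator of `C`. Both
size alternatives yield `q ∣ n` and `|C|(l+q) = q^n`; nothing else about the parameters is used. Now
`A = qS - n`, where `S` is the sum of the commuting coordinate averages and has integer eigenvalues.
As `q ∣ n`, no eigenvalue of `A` lies strictly between `-q` and `0`, so `B = A(A+q)` is positive
semidefinite. Minimum distance 3 gives `⟨f, Af⟩ = 0` and makes `Af` a 0/1 function, so `⟨f, Bf⟩ =
⟨Af, Af⟩ = l|C|`. The constant part of `f` alone contributes exactly this much. The rest of `f`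
therefore lies in the kernel of `B`, that is, `A²f + qAf = l`
(`hammingAdj_hammingAdj_indicator_code`). With the count of walks of length two, this equation
determines the covering radius, the intersection numbers and the packing constants. For sizes coming
from a 1-perfect code over an arbitrary alphabet, divisibility is Lloyd's condition, and the size
follows by pairing `f + Af = 1` with the indicator of `x j = a`. -/

/-! ### Sums of commuting projections -/

section CommutingProjections

variable {ι W : Type*} [Fintype W]

/-- For a sum `S` of commuting symmetric idempotents and an integer `a`, the operator
`(S - a) (S - a + 1)` is positive semidefinite. -/
theorem quadratic_nonneg_of_sum_commuting_projections
    (P : ι → Module.End ℝ (W → ℝ)) (hidem : ∀ i v, P i (P i v) = P i v)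
    (hcomm : ∀ i j v, P i (P j v) = P j (P i v))
    (hsymm : ∀ i u v, P i u ⬝ᵥ v = u ⬝ᵥ P i v) (s : Finset ι) :
    ∀ (a : ℤ) (v : W → ℝ),
      0 ≤ (∑ i ∈ s, P i v) ⬝ᵥ (∑ i ∈ s, P i v) - (2 * a - 1) * (v ⬝ᵥ ∑ i ∈ s, P i v)
        + a * (a - 1) * (v ⬝ᵥ v) := by
  classical
  induction s using Finset.induction_on with
  | empty =>
    intro a v
    have h1 : (0 : ℝ) ≤ a * (a - 1) := by
      have : 0 ≤ a * (a - 1) := by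
        rcases le_or_gt a 0 with h | h
        · nlinarith
        · nlinarith [show 1 ≤ a from h]
      exact_mod_cast this
    have h2 : 0 ≤ v ⬝ᵥ v := Finset.sum_nonneg fun i _ => mul_self_nonneg _
    simpa using mul_nonneg h1 h2
  | insert p s hp ih =>
    intro a v
    -- Split `v` along the image and kernel of `P p`. The full sum acts on `u` as the smaller sum
    -- plus 1 and on `w` as the smaller sum, so the induction hypothesis is used at `a - 1` on `u`
    -- and at `a` on `w`; cross terms vanish by orthogonality.
    obtain ⟨u, hu⟩ : ∃ u, u = P p v := ⟨_, rfl⟩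
    obtain ⟨w, hw⟩ : ∃ w, w = v - u := ⟨_, rfl⟩
    have hPu : P p u = u := by rw [hu, hidem]
    have hPw : P p w = 0 := by rw [hw, map_sub, hPu, hu, sub_self]
    have hv : v = u + w := by rw [hw]; abel
    have orth : ∀ x y : W → ℝ, P p x = x → P p y = 0 → x ⬝ᵥ y = 0 := by
      intro x y hx hy
      rw [← hx, hsymm, hy, dotProduct_zero]
    have hSu : P p (∑ i ∈ s, P i u) = ∑ i ∈ s, P i u := by
      rw [map_sum]
      exact Finset.sum_congr rfl fun i _ => by rw [hcomm, hPu]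
    have hSw : P p (∑ i ∈ s, P i w) = 0 := by
      rw [map_sum]
      exact Finset.sum_eq_zero fun i _ => by rw [hcomm, hPw, map_zero]
    have hS : ∑ i ∈ insert p s, P i v = u + ∑ i ∈ s, P i u + ∑ i ∈ s, P i w := by
      rw [Finset.sum_insert hp, ← hu, hv]
      simp only [map_add, Finset.sum_add_distrib]
      abel
    have h1 := ih (a - 1) u
    have h2 := ih a w
    rw [hS, hv]
    generalize ∑ i ∈ s, P i u = x at *
    generalize ∑ i ∈ s, P i w = y at *
    have e1 := orth u w hPu hPw
    have e2 := orth u y hPu hSw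
    have e3 := orth x w hSu hPw
    have e4 := orth x y hSu hSw
    simp only [add_dotProduct, dotProduct_add, dotProduct_comm y u, dotProduct_comm y x,
      dotProduct_comm w u, dotProduct_comm w x, dotProduct_comm x u, e1, e2, e3, e4] at *
    push_cast at h1
    nlinarith

/-- The eigenvalues of a sum of commuting idempotents are integers. -/
theorem eigenvalue_sum_commuting_idempotents
    (P : ι → Module.End ℝ (W → ℝ)) (hidem : ∀ i v, P i (P i v) = P i v)
    (hcomm : ∀ i j v, P i (P j v) = P j (P i v)) (s : Finset ι) :
    ∀ (t : ℝ) (v : W → ℝ), v ≠ 0 → ∑ i ∈ s, P i v = t • v → ∃ k : ℤ, t = k := by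
  classical
  induction s using Finset.induction_on with
  | empty =>
    intro t v hv h
    rw [Finset.sum_empty, eq_comm, smul_eq_zero] at h
    exact ⟨0, by simpa [hv] using h⟩
  | insert p s hp ih =>
    intro t v hv h
    rw [Finset.sum_insert hp] at h
    have hSP : ∑ i ∈ s, P i (P p v) = (t - 1) • P p v := by
      have h' := congrArg (P p) h
      rw [map_add, map_sum, hidem, map_smul] at h'
      rw [Finset.sum_congr rfl fun i _ => hcomm i p v, sub_smul, one_smul, ← h']
      abel
    -- Either `v` itself or its nonzero projection is an eigenvector of the smaller sum, with
    -- eigenvalue `t` or `t - 1`.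
    by_cases hu : P p v = 0
    · rw [hu, zero_add] at h
      exact ih t v hv h
    · obtain ⟨k, hk⟩ := ih (t - 1) _ hu hSP
      exact ⟨k + 1, by push_cast; linarith⟩

/-- A vector on which a positive semidefinite symmetric form vanishes lies in its kernel. -/
theorem eq_zero_of_quadratic_eq_zero (B : Module.End ℝ (W → ℝ))
    (hsymm : ∀ u v, B u ⬝ᵥ v = u ⬝ᵥ B v) (hpos : ∀ v, 0 ≤ v ⬝ᵥ B v) (g : W → ℝ)
    (hg : g ⬝ᵥ B g = 0) : B g = 0 := by
  -- The form along the line `g + t • B g` is a nonnegative quadratic in `t` without constant term,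
  -- so its linear coefficient vanishes.
  have h : ∀ t : ℝ, 0 ≤ (B g ⬝ᵥ B (B g)) * (t * t) + (2 * (B g ⬝ᵥ B g)) * t + 0 := by
    intro t
    have := hpos (g + t • B g)
    simp only [map_add, map_smul, add_dotProduct, dotProduct_add, smul_dotProduct,
      dotProduct_smul, smul_eq_mul, hg, ← hsymm g (B g)] at this
    linarith
  have hd := discrim_le_zero h
  rw [discrim] at hd
  have : B g ⬝ᵥ B g = 0 := by nlinarith [sq_nonneg (B g ⬝ᵥ B g)]
  exact dotProduct_self_eq_zero.mp this

end CommutingProjections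

/-! ### The adjacency operator as a sum of coordinate averages -/

section HammingOperators

variable {n q : ℕ}

/-- Summation over all values of the `i`-th coordinate. -/
def coordSum (i : Fin n) : Module.End ℝ (Word n q → ℝ) where
  toFun g x := ∑ a, g (Function.update x i a)
  map_add' g h := by ext x; simp [Finset.sum_add_distrib]
  map_smul' c g := by ext x; simp [Finset.mul_sum]

theorem coordSum_apply (i : Fin n) (g : Word n q → ℝ) (x : Word n q) :
    coordSum i g x = ∑ a, g (Function.update x i a) := rfl

theorem coordSum_coordSum_self (i : Fin n) (g : Word n q → ℝ) :
    coordSum i (coordSum i g) = (q : ℝ) • coordSum i g := by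
  ext x
  simp [coordSum_apply]

theorem coordSum_comm (i j : Fin n) (g : Word n q → ℝ) :
    coordSum i (coordSum j g) = coordSum j (coordSum i g) := by
  rcases eq_or_ne i j with rfl | hij
  · rfl
  ext x
  simp only [coordSum_apply]
  rw [Finset.sum_comm]
  simp only [Function.update_comm hij]

/-- Exchanging the new symbol with the one it replaces is an involution on pairs (word, symbol). -/
theorem coordSum_dotProduct (i : Fin n) (f g : Word n q → ℝ) :
    coordSum i f ⬝ᵥ g = f ⬝ᵥ coordSum i g := by
  simp only [dotProduct, coordSum_apply, Finset.sum_mul, Finset.mul_sum]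
  rw [← Fintype.sum_prod_type', ← Fintype.sum_prod_type']
  have hinv : Function.Involutive
      (fun p : Word n q × Fin q => (Function.update p.1 i p.2, p.1 i)) := by
    rintro ⟨x, a⟩
    simp
  refine Fintype.sum_equiv hinv.toPerm _ _ ?_
  rintro ⟨x, a⟩
  simp

/-- The average over all values of the `i`-th coordinate. -/
noncomputable def coordAvg (i : Fin n) : Module.End ℝ (Word n q → ℝ) := (q : ℝ)⁻¹ • coordSum i

theorem coordAvg_coordAvg_self (hq : q ≠ 0) (i : Fin n) (g : Word n q → ℝ) :
    coordAvg i (coordAvg i g) = coordAvg i g := by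
  have : (q : ℝ) ≠ 0 := by exact_mod_cast hq
  simp [coordAvg, coordSum_coordSum_self, smul_smul, this]

theorem coordAvg_comm (i j : Fin n) (g : Word n q → ℝ) :
    coordAvg i (coordAvg j g) = coordAvg j (coordAvg i g) := by
  simp [coordAvg, coordSum_comm i j]

theorem coordAvg_dotProduct (i : Fin n) (f g : Word n q → ℝ) :
    coordAvg i f ⬝ᵥ g = f ⬝ᵥ coordAvg i g := by
  simp [coordAvg, coordSum_dotProduct]

/-- The adjacency operator of the Hamming graph. -/
def hammingAdj (n q : ℕ) : Module.End ℝ (Word n q → ℝ) where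
  toFun g x := ∑ y with hammingDist x y = 1, g y
  map_add' g h := by ext x; simp [Finset.sum_add_distrib]
  map_smul' c g := by ext x; simp [Finset.mul_sum]

theorem hammingAdj_apply (g : Word n q → ℝ) (x : Word n q) :
    hammingAdj n q g x = ∑ y with hammingDist x y = 1, g y := rfl

theorem hammingAdj_dotProduct (f g : Word n q → ℝ) :
    hammingAdj n q f ⬝ᵥ g = f ⬝ᵥ hammingAdj n q g := by
  simp only [dotProduct, hammingAdj_apply, Finset.sum_mul, Finset.mul_sum, Finset.sum_filter]
  rw [Finset.sum_comm]
  refine Finset.sum_congr rfl fun x _ => Finset.sum_congr rfl fun y _ => ?_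
  rw [hammingDist_comm]
  split_ifs <;> simp

theorem hammingDist_eq_sum_ite (x y : Word n q) :
    hammingDist x y = ∑ k, if x k ≠ y k then 1 else 0 := by
  rw [hammingDist, Finset.card_filter]

/-- Only coordinate `i` changes its contribution; the additive form avoids truncated subtraction. -/
theorem hammingDist_update_add (x y : Word n q) (i : Fin n) (a : Fin q) :
    hammingDist (Function.update x i a) y + (if x i ≠ y i then 1 else 0)
      = hammingDist x y + (if a ≠ y i then 1 else 0) := by
  rw [hammingDist_eq_sum_ite, hammingDist_eq_sum_ite,
    ← Finset.add_sum_erase _ _ (Finset.mem_univ i),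
    ← Finset.add_sum_erase _ (fun k => if x k ≠ y k then 1 else 0) (Finset.mem_univ i)]
  have : ∑ k ∈ Finset.univ.erase i, (if Function.update x i a k ≠ y k then 1 else 0)
      = ∑ k ∈ Finset.univ.erase i, if x k ≠ y k then 1 else 0 :=
    Finset.sum_congr rfl fun k hk => by
      rw [Function.update_of_ne (Finset.ne_of_mem_erase hk)]
  rw [this, Function.update_self]
  omega

theorem hammingDist_update_right {x : Word n q} {i : Fin n} {a : Fin q} (h : a ≠ x i) :
    hammingDist x (Function.update x i a) = 1 := by
  have := hammingDist_update_add x x i a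
  simp only [ne_eq, not_true_eq_false, if_false, h, not_false_eq_true, if_true,
    hammingDist_self] at this
  rw [hammingDist_comm]
  omega

theorem hammingAdj_eq_sum_update (g : Word n q → ℝ) (x : Word n q) :
    hammingAdj n q g x = ∑ i, ∑ a ∈ Finset.univ.erase (x i), g (Function.update x i a) := by
  rw [hammingAdj_apply, Finset.sum_sigma']
  symm
  refine Finset.sum_bij (fun p _ => Function.update x p.1 p.2) ?_ ?_ ?_ ?_
  · rintro ⟨i, a⟩ h
    simp only [Finset.mem_sigma, Finset.mem_univ, Finset.mem_erase, and_true, true_and] at h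
    simpa using hammingDist_update_right h
  · rintro ⟨i, a⟩ h ⟨j, b⟩ h' e
    simp only [Finset.mem_sigma, Finset.mem_univ, Finset.mem_erase, and_true, true_and] at h h'
    have e1 := congrFun e i
    dsimp only at e1
    rw [Function.update_self] at e1
    rcases eq_or_ne i j with rfl | hij
    · rw [Function.update_self] at e1
      rw [e1]
    · rw [Function.update_of_ne hij] at e1
      exact absurd e1 h
  · intro y hy
    simp only [Finset.mem_filter, Finset.mem_univ, true_and] at hy
    rw [hammingDist, Finset.card_eq_one] at hy
    obtain ⟨i, hi⟩ := hy
    have hmem : ∀ k, x k ≠ y k ↔ k = i := fun k => by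
      simpa using Finset.ext_iff.mp hi k
    refine ⟨⟨i, y i⟩, ?_, ?_⟩
    · simpa using ((hmem i).mpr rfl).symm
    · ext1 k
      rcases eq_or_ne k i with rfl | hk
      · simp
      · rw [Function.update_of_ne hk]
        exact not_not.mp fun h => hk ((hmem k).mp h)
  · intros
    rfl

theorem hammingAdj_eq_sum_coordSum (g : Word n q → ℝ) :
    hammingAdj n q g = ∑ i, coordSum i g - (n : ℝ) • g := by
  ext x
  have (i : Fin n) : ∑ a ∈ Finset.univ.erase (x i), g (Function.update x i a)
      = coordSum i g x - g x := by
    rw [coordSum_apply, ← Finset.add_sum_erase _ _ (Finset.mem_univ (x i)),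
      Function.update_eq_self]
    ring
  simp [hammingAdj_eq_sum_update, this]

theorem hammingAdj_eq_sum_coordAvg (hq : q ≠ 0) (g : Word n q → ℝ) :
    hammingAdj n q g = (q : ℝ) • ∑ i, coordAvg i g - (n : ℝ) • g := by
  have : (q : ℝ) ≠ 0 := by exact_mod_cast hq
  simp [hammingAdj_eq_sum_coordSum, coordAvg, ← Finset.smul_sum, smul_smul, this]

theorem hammingAdj_one : hammingAdj n q 1 = ((n : ℝ) * (q - 1)) • 1 := by
  ext x
  simp [hammingAdj_eq_sum_coordSum, coordSum_apply]
  ring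

/-- Counting the walks of length two in the Hamming graph. -/
theorem hammingAdj_hammingAdj (g : Word n q → ℝ) (x : Word n q) :
    hammingAdj n q (hammingAdj n q g) x
      = n * (q - 1) * g x + (q - 2) * hammingAdj n q g x
        + 2 * ∑ y with hammingDist x y = 2, g y := by
  have key (y : Word n q) : (∑ i, ∑ a ∈ Finset.univ.erase (x i),
        if hammingDist (Function.update x i a) y = 1 then (1 : ℝ) else 0)
      = (if hammingDist x y = 0 then (n : ℝ) * (q - 1) else 0)
        + (if hammingDist x y = 1 then (q : ℝ) - 2 else 0)
        + (if hammingDist x y = 2 then 2 else 0) := by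
    -- Where `x` and `y` agree, every change of symbol raises the distance. Where they differ, one
    -- change lowers it and `q - 2` preserve it.
    have hi (i : Fin n) : (∑ a ∈ Finset.univ.erase (x i),
          if hammingDist (Function.update x i a) y = 1 then (1 : ℝ) else 0)
        = (if hammingDist x y = 0 then (q : ℝ) - 1 else 0)
          + (if x i ≠ y i then 1 else 0) * ((if hammingDist x y = 1 then (q : ℝ) - 2 else 0)
          + (if hammingDist x y = 2 then 1 else 0)) := by
      have hq : 1 ≤ q := (x i).pos
      by_cases hxy : x i = y i
      · have h1 : ∀ a ∈ Finset.univ.erase (x i),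
            (if hammingDist (Function.update x i a) y = 1 then (1 : ℝ) else 0)
              = if hammingDist x y = 0 then 1 else 0 := by
          intro a ha
          have ha' : a ≠ y i := hxy ▸ Finset.ne_of_mem_erase ha
          have := hammingDist_update_add x y i a
          simp only [hxy, ne_eq, not_true_eq_false, if_false, ha', not_false_eq_true,
            if_true] at this
          simp only [show hammingDist (Function.update x i a) y = 1 ↔ hammingDist x y = 0 by omega]
        rw [Finset.sum_congr rfl h1]
        simp [hxy, Finset.card_erase_of_mem, Nat.cast_sub hq]
      · have hmem : y i ∈ Finset.univ.erase (x i) := by simp [Ne.symm hxy]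
        rw [← Finset.add_sum_erase _ _ hmem]
        have h0 : hammingDist x y ≠ 0 := fun h => hxy (congrFun (hammingDist_eq_zero.mp h) i)
        have h1 : ∀ a ∈ (Finset.univ.erase (x i)).erase (y i),
            (if hammingDist (Function.update x i a) y = 1 then (1 : ℝ) else 0)
              = if hammingDist x y = 1 then 1 else 0 := by
          intro a ha
          have ha' : a ≠ y i := Finset.ne_of_mem_erase ha
          have := hammingDist_update_add x y i a
          simp only [hxy, ne_eq, if_true, ha', not_false_eq_true] at this
          simp only [show hammingDist (Function.update x i a) y = 1 ↔ hammingDist x y = 1 by omega]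
        have h2 : (if hammingDist (Function.update x i (y i)) y = 1 then (1 : ℝ) else 0)
            = if hammingDist x y = 2 then 1 else 0 := by
          have := hammingDist_update_add x y i (y i)
          simp only [hxy, ne_eq, not_true_eq_false, if_false, not_false_eq_true, if_true] at this
          simp only [show hammingDist (Function.update x i (y i)) y = 1 ↔ hammingDist x y = 2
            by omega]
        have hq2 : 2 ≤ q := by
          have := (x i).isLt
          have := (y i).isLt
          have : (x i : ℕ) ≠ y i := fun h => hxy (Fin.ext h)
          omega
        rw [Finset.sum_congr rfl h1, h2, Finset.sum_const, Finset.card_erase_of_mem hmem,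
          Finset.card_erase_of_mem (Finset.mem_univ _), Finset.card_univ, Fintype.card_fin,
          Nat.sub_sub, nsmul_eq_mul, Nat.cast_sub hq2]
        simp only [h0, hxy, ne_eq, not_false_eq_true, if_true, if_false]
        split_ifs <;> push_cast <;> ring
    have hd : (∑ i, if x i ≠ y i then (1 : ℝ) else 0) = hammingDist x y := by
      rw [hammingDist_eq_sum_ite]
      push_cast
      rfl
    rw [Finset.sum_congr rfl fun i _ => hi i, Finset.sum_add_distrib, ← Finset.sum_mul, hd,
      Finset.sum_const, Finset.card_univ, Fintype.card_fin, nsmul_eq_mul]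
    rcases h : hammingDist x y with _ | _ | _ | d
    · norm_num
    · norm_num
    · norm_num
    · rw [if_neg (by omega), if_neg (by omega), if_neg (by omega), if_neg (by omega),
        if_neg (by omega)]
      ring
  have h1 : hammingAdj n q (hammingAdj n q g) x = ∑ y, (∑ i, ∑ a ∈ Finset.univ.erase (x i),
        if hammingDist (Function.update x i a) y = 1 then (1 : ℝ) else 0) * g y := by
    rw [hammingAdj_eq_sum_update]
    simp only [hammingAdj_apply, Finset.sum_filter, Finset.sum_mul, ite_mul, one_mul, zero_mul]
    rw [Finset.sum_comm]
    refine Finset.sum_congr rfl fun i _ => ?_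
    rw [Finset.sum_comm]
  rw [h1, Finset.sum_congr rfl fun y _ => by rw [key y]]
  simp only [add_mul, Finset.sum_add_distrib, ite_mul, zero_mul, hammingDist_eq_zero,
    hammingAdj_apply, ← Finset.sum_filter, ← Finset.mul_sum]
  simp [Finset.filter_eq]

end HammingOperators

/-! ### From the quadratic equation to regularity and packing -/

section Codes

variable {n q : ℕ}

theorem sum_indicator_one_eq_ncard {α : Type*} (s : Finset α) (T : Set α) :
    ∑ y ∈ s, T.indicator (1 : α → ℝ) y = ({y | y ∈ T ∧ y ∈ s}.ncard : ℝ) := by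
  classical
  have : {y | y ∈ T ∧ y ∈ s} = (s.filter (· ∈ T) : Finset α) := by
    ext
    simp [and_comm]
  rw [this, Set.ncard_coe_finset]
  simp [Set.indicator_apply]

theorem hammingAdj_indicator (T : Set (Word n q)) (x : Word n q) :
    hammingAdj n q (T.indicator 1) x
      = ({y | (hammingGraph n q).Adj x y ∧ y ∈ T}.ncard : ℝ) := by
  rw [hammingAdj_apply, sum_indicator_one_eq_ncard]
  simp [hammingGraph, and_comm]

theorem codewordsAt_eq_sum (C : Set (Word n q)) (x : Word n q) (i : ℕ) :
    (codewordsAt C x i : ℝ) = ∑ y with hammingDist x y = i, C.indicator (1 : Word n q → ℝ) y := by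
  rw [sum_indicator_one_eq_ncard]
  simp [codewordsAt]

theorem sum_hammingAdj (f : Word n q → ℝ) :
    ∑ x, hammingAdj n q f x = n * (q - 1) * ∑ x, f x := by
  have h := hammingAdj_dotProduct f 1
  rw [hammingAdj_one, dotProduct_smul, dotProduct_one, dotProduct_one, smul_eq_mul] at h
  exact h

theorem mem_distLayer_zero {C : Set (Word n q)} {x : Word n q} : x ∈ distLayer C 0 ↔ x ∈ C := by
  simp [distLayer]

theorem eq_of_mem_distLayer {C : Set (Word n q)} {x : Word n q} {i j : ℕ}
    (hi : x ∈ distLayer C i) (hj : x ∈ distLayer C j) : i = j := by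
  obtain ⟨⟨c, hc, rfl⟩, h⟩ := hi
  obtain ⟨⟨d, hd, rfl⟩, h'⟩ := hj
  exact le_antisymm (h d hd) (h' c hc)

/-- Two codewords adjacent to the same word would be at distance at most 2, and no codeword is
adjacent to another. -/
theorem hammingAdj_indicator_code {C : Set (Word n q)} (hC : HasMinDist C 3) :
    hammingAdj n q (C.indicator 1) = (distLayer C 1).indicator 1 := by
  ext x
  rw [hammingAdj_apply]
  by_cases hx : x ∈ distLayer C 1
  · obtain ⟨⟨c, hc, hxc⟩, -⟩ := id hx
    rw [Set.indicator_of_mem hx, Finset.sum_eq_single_of_mem c (by simpa using hxc),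
      Set.indicator_of_mem hc]
    · rfl
    · intro d hd hdc
      refine Set.indicator_of_notMem (fun hdC => ?_) _
      have h1 := hC.2 d hdC c hc hdc
      have h2 := hammingDist_triangle_left d c x
      simp only [Finset.mem_filter, Finset.mem_univ, true_and] at hd
      omega
  · rw [Set.indicator_of_notMem hx]
    refine Finset.sum_eq_zero fun c hc => Set.indicator_of_notMem (fun hcC => hx ?_) _
    simp only [Finset.mem_filter, Finset.mem_univ, true_and] at hc
    refine ⟨⟨c, hcC, hc⟩, fun d hd => ?_⟩
    by_contra! h
    have hxd : x = d := hammingDist_eq_zero.mp (by omega)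
    subst hxd
    have := hC.2 x hd c hcC (by rintro rfl; simp at hc)
    omega

/-- If `q` divides `n`, the operator `A (A + q)` is positive semidefinite for the adjacency
operator `A` of the Hamming graph `H(n,q)`. -/
theorem hammingAdj_quadratic_nonneg (hq : q ≠ 0) (hqn : q ∣ n) (v : Word n q → ℝ) :
    0 ≤ v ⬝ᵥ (hammingAdj n q (hammingAdj n q v) + (q : ℝ) • hammingAdj n q v) := by
  obtain ⟨k, rfl⟩ := hqn
  -- With `k = n / q` one has `A = q(S - k)`, so `A(A + q) = q²(S - k)(S - k + 1)`.
  have h := quadratic_nonneg_of_sum_commuting_projections (W := Word (q * k) q) coordAvg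
    (coordAvg_coordAvg_self hq) coordAvg_comm coordAvg_dotProduct Finset.univ (k : ℤ) v
  rw [dotProduct_add, ← hammingAdj_dotProduct, dotProduct_smul]
  simp only [hammingAdj_eq_sum_coordAvg hq]
  generalize ∑ i, coordAvg i v = w at *
  simp only [sub_dotProduct, dotProduct_sub, smul_dotProduct, dotProduct_smul, smul_eq_mul,
    dotProduct_comm w v]
  push_cast at *
  have := mul_nonneg (sq_nonneg (q : ℝ)) h
  linarith

/-- The characteristic function of a shortened-`1`-perfect-like code satisfies a quadratic
equation in the adjacency operator. -/
theorem hammingAdj_hammingAdj_indicator_code {C : Set (Word n q)} (hC : HasMinDist C 3)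
    (hq : 2 ≤ q) (hqn : q ∣ n) (hM : C.ncard * (n * (q - 1) + q) = q ^ n) (x : Word n q) :
    hammingAdj n q (hammingAdj n q (C.indicator 1)) x
      = n * (q - 1) - q * hammingAdj n q (C.indicator 1) x := by
  have hq0 : q ≠ 0 := by omega
  obtain ⟨f, hf⟩ : ∃ f : Word n q → ℝ, f = C.indicator 1 := ⟨_, rfl⟩
  have hf1 := hammingAdj_indicator_code hC
  rw [← hf] at hf1 ⊢
  set l : ℝ := n * (q - 1) with hl
  have hMl : (C.ncard : ℝ) * (l + q) = q ^ n := by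
    have := congrArg (Nat.cast : ℕ → ℝ) hM
    rw [hl]
    push_cast [Nat.cast_sub (show 1 ≤ q by omega)] at this
    exact this
  obtain ⟨M, hMdef⟩ : ∃ M : ℝ, M = (C.ncard : ℝ) := ⟨_, rfl⟩
  rw [← hMdef] at hMl
  have hsum : ∑ x, f x = M := by
    rw [hf, sum_indicator_one_eq_ncard]
    simp [hMdef]
  have hqn0 : (q : ℝ) ^ n ≠ 0 := pow_ne_zero _ (by exact_mod_cast hq0)
  have hlq : l + q ≠ 0 := right_ne_zero_of_mul (hMl ▸ hqn0)
  let A := hammingAdj n q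
  let B : Module.End ℝ (Word n q → ℝ) := A * A + (q : ℝ) • A
  have hB (v) : B v = A (A v) + (q : ℝ) • A v := rfl
  have hBsymm (u v) : B u ⬝ᵥ v = u ⬝ᵥ B v := by
    simp only [hB, A, add_dotProduct, dotProduct_add, smul_dotProduct, dotProduct_smul,
      hammingAdj_dotProduct]
  have hB1 : B 1 = (l * (l + q)) • 1 := by
    simp only [hB, A, hammingAdj_one, map_smul, smul_smul, ← add_smul]
    congr 1
    ring
  have hdisj : f ⬝ᵥ A f = 0 := by
    refine Finset.sum_eq_zero fun y _ => ?_
    by_cases hy : y ∈ C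
    · have : y ∉ distLayer C 1 := fun h =>
        absurd (eq_of_mem_distLayer (mem_distLayer_zero.mpr hy) h) (by simp)
      simp [A, hf1, this]
    · simp [hf, hy]
  have hAA : f ⬝ᵥ A (A f) = l * M := by
    rw [← hammingAdj_dotProduct, ← hsum, ← sum_hammingAdj]
    refine Finset.sum_congr rfl fun y _ => ?_
    rw [hf1]
    by_cases hy : y ∈ distLayer C 1 <;> simp [hy]
  have hfB : f ⬝ᵥ B f = l * M := by
    rw [hB, dotProduct_add, dotProduct_smul, hdisj, hAA]
    simp
  have h1 : (1 : Word n q → ℝ) ⬝ᵥ 1 = q ^ n := by simp [dotProduct]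
  have hf1' : f ⬝ᵥ 1 = M := by rw [dotProduct_one, hsum]
  -- By `hMl`, `(l + q)⁻¹` is the density of `C`, so subtracting it removes the component of `f`
  -- along the constants.
  have hBg : B (f - (l + q)⁻¹ • 1) = 0 := by
    refine eq_zero_of_quadratic_eq_zero B hBsymm
      (fun v => hammingAdj_quadratic_nonneg hq0 hqn v) _ ?_
    have h2 : (1 : Word n q → ℝ) ⬝ᵥ B f = l * (l + q) * M := by
      rw [← hBsymm, hB1, smul_dotProduct, dotProduct_comm, hf1', smul_eq_mul]
    simp only [map_sub, map_smul, sub_dotProduct, dotProduct_sub, smul_dotProduct,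
      dotProduct_smul, smul_eq_mul, hfB, h2, hB1, h1, hf1', ← hMl]
    field_simp
    ring
  rw [map_sub, map_smul, hB1, smul_smul, sub_eq_zero, hB] at hBg
  have := congrFun hBg x
  simp only [Pi.add_apply, Pi.smul_apply, smul_eq_mul, Pi.one_apply, mul_one] at this
  rw [show (l + q)⁻¹ * (l * (l + q)) = l by field_simp] at this
  change A (A f) x = l - q * A f x
  linarith

theorem exists_forall_eq_of_forall_eq {α : Type*} (s : Set α) (N : α → ℕ)
    (h : ∀ x ∈ s, ∀ y ∈ s, N x = N y) : ∃ k, ∀ x ∈ s, N x = k := by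
  rcases s.eq_empty_or_nonempty with rfl | ⟨y, hy⟩
  · exact ⟨0, by simp⟩
  · exact ⟨N y, fun x hx => h x hx y hy⟩

theorem isCompletelyRegular_isUniformlyPacked {C : Set (Word n q)} (hC : HasMinDist C 3)
    (hq : 2 ≤ q) (hn : 1 ≤ n) (hqn : q ∣ n) (hM : C.ncard * (n * (q - 1) + q) = q ^ n) :
    IsCompletelyRegular C ∧ IsUniformlyPacked C := by
  have hq2 : (2 : ℝ) ≤ q := by exact_mod_cast hq
  have hn1 : (1 : ℝ) ≤ n := by exact_mod_cast hn
  have hl : (0 : ℝ) < n * (q - 1) := mul_pos (by linarith) (by linarith)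
  have hAA := hammingAdj_hammingAdj_indicator_code hC hq hqn hM
  have hA := hammingAdj_indicator_code hC
  -- Compare the quadratic equation with the count of walks of length two. Off `C` and its first
  -- layer the right side is `n(q-1) > 0`, which bounds the covering radius by 2.
  have htwo (x : Word n q) : 2 * (codewordsAt C x 2 : ℝ)
      = n * (q - 1) * (1 - C.indicator 1 x) - (2 * q - 2) * (distLayer C 1).indicator 1 x := by
    have h1 := hammingAdj_hammingAdj (C.indicator 1) x
    rw [hAA, hA, ← codewordsAt_eq_sum] at h1
    linarith
  have hindC {x : Word n q} {i : ℕ} (hx : x ∈ distLayer C i) :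
      C.indicator (1 : Word n q → ℝ) x = if i = 0 then 1 else 0 := by
    split_ifs with h
    · subst h
      rw [Set.indicator_of_mem (mem_distLayer_zero.mp hx), Pi.one_apply]
    · exact Set.indicator_of_notMem
        (fun h' => h (eq_of_mem_distLayer hx (mem_distLayer_zero.mpr h'))) _
  have hind {x : Word n q} {i : ℕ} (hx : x ∈ distLayer C i) :
      (distLayer C 1).indicator (1 : Word n q → ℝ) x = if i = 1 then 1 else 0 := by
    split_ifs with h
    · subst h
      rw [Set.indicator_of_mem hx, Pi.one_apply]
    · exact Set.indicator_of_notMem (fun h' => h (eq_of_mem_distLayer hx h')) _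
  have hcov (x : Word n q) (h0 : x ∉ C) (h1 : x ∉ distLayer C 1) : x ∈ distLayer C 2 := by
    have h := htwo x
    rw [Set.indicator_of_notMem h0, Set.indicator_of_notMem h1] at h
    have hne : codewordsAt C x 2 ≠ 0 := by
      intro h'
      rw [h', Nat.cast_zero] at h
      linarith
    obtain ⟨c, hc, hxc⟩ := Set.nonempty_of_ncard_ne_zero hne
    refine ⟨⟨c, hc, hxc⟩, fun d hd => ?_⟩
    by_contra! hlt
    obtain h' | h' : hammingDist x d = 0 ∨ hammingDist x d = 1 := by omega
    · exact h0 (hammingDist_eq_zero.mp h' ▸ hd)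
    · refine h1 ⟨⟨d, hd, h'⟩, fun c hc => Nat.one_le_iff_ne_zero.mpr fun h' => ?_⟩
      exact h0 (hammingDist_eq_zero.mp h' ▸ hc)
  have hlayers (x : Word n q) : x ∈ distLayer C 0 ∨ x ∈ distLayer C 1 ∨ x ∈ distLayer C 2 := by
    by_cases h0 : x ∈ C
    · exact Or.inl (mem_distLayer_zero.mpr h0)
    · by_cases h1 : x ∈ distLayer C 1
      · exact Or.inr (Or.inl h1)
      · exact Or.inr (Or.inr (hcov x h0 h1))
  have hind2 : (distLayer C 2).indicator (1 : Word n q → ℝ)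
      = 1 - C.indicator 1 - (distLayer C 1).indicator 1 := by
    ext x
    simp only [Pi.sub_apply, Pi.one_apply]
    rcases hlayers x with hx | hx | hx <;> rw [hindC hx, hind hx]
    · rw [Set.indicator_of_notMem fun h => absurd (eq_of_mem_distLayer hx h) (by simp)]
      norm_num
    · rw [Set.indicator_of_notMem fun h => absurd (eq_of_mem_distLayer hx h) (by simp)]
      norm_num
    · rw [Set.indicator_of_mem hx]
      norm_num
  refine ⟨fun i j => exists_forall_eq_of_forall_eq _ _ fun x hx y hy => ?_, ?_⟩
  -- The span of `1`, `f` and `Af` is `A`-invariant. Each neighbour count depends only on the value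
  -- of `Af`, which is constant on every layer.
  · obtain ⟨φ, hφ⟩ : ∃ φ : ℝ → ℝ, ∀ z, hammingAdj n q ((distLayer C j).indicator 1) z
        = φ ((distLayer C 1).indicator 1 z) := by
      match j with
      | 0 =>
        refine ⟨id, fun z => ?_⟩
        rw [show distLayer C 0 = C from Set.ext fun _ => mem_distLayer_zero, hA, id]
      | 1 => exact ⟨fun t => n * (q - 1) - q * t, fun z => by rw [← hA, hAA]⟩
      | 2 =>
        refine ⟨fun t => n * (q - 1) - t - (n * (q - 1) - q * t), fun z => ?_⟩
        rw [hind2, map_sub, map_sub, hammingAdj_one]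
        simp only [← hA, Pi.sub_apply, hAA, Pi.smul_apply, Pi.one_apply, smul_eq_mul, mul_one]
      | j + 3 =>
        refine ⟨0, fun z => ?_⟩
        have : distLayer C (j + 3) = ∅ := by
          refine Set.eq_empty_of_forall_notMem fun w hw => ?_
          rcases hlayers w with h | h | h <;> have := eq_of_mem_distLayer hw h <;> omega
        rw [this, Set.indicator_empty]
        exact congrFun (map_zero (hammingAdj n q)) z
    have h := hφ x
    rw [hind hx, ← hind hy, ← hφ y, hammingAdj_indicator, hammingAdj_indicator] at h
    exact_mod_cast h
  · have hpack (i : ℕ) : ∃ k, ∀ x ∈ distLayer C i, codewordsAt C x 2 = k := by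
      refine exists_forall_eq_of_forall_eq _ _ fun x hx y hy => ?_
      have h := htwo x
      rw [hindC hx, hind hx, ← hindC hy, ← hind hy, ← htwo y] at h
      exact_mod_cast mul_left_cancel₀ two_ne_zero h
    obtain ⟨k₁, h₁⟩ := hpack 1
    obtain ⟨k₂, h₂⟩ := hpack 2
    refine ⟨1, k₁, k₂, Or.inl hC, ⟨fun x => ?_, ?_⟩, h₁, h₂⟩
    · rcases hlayers x with ⟨⟨c, hc, h⟩, -⟩ | ⟨⟨c, hc, h⟩, -⟩ | ⟨⟨c, hc, h⟩, -⟩ <;>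
        exact ⟨c, hc, by omega⟩
    -- Without a second layer the unit balls around codewords would fill the space, giving `|C|(1 +
    -- l) = q^n = |C|(l + q)` and contradicting `q ≥ 2`.
    · by_contra hempty
      rw [Set.not_nonempty_iff_eq_empty] at hempty
      rw [hempty, Set.indicator_empty, ← hA] at hind2
      have hs : ∑ x, C.indicator (1 : Word n q → ℝ) x = C.ncard := by
        rw [sum_indicator_one_eq_ncard]
        simp
      have h0 : ∑ x : Word n q, (1 - C.indicator 1 x - hammingAdj n q (C.indicator 1) x) = 0 :=
        Finset.sum_eq_zero fun x _ => (congrFun hind2 x).symm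
      rw [Finset.sum_sub_distrib, Finset.sum_sub_distrib, sum_hammingAdj, hs] at h0
      have hM' := congrArg (Nat.cast : ℕ → ℝ) hM
      push_cast [Nat.cast_sub (show 1 ≤ q by omega)] at hM'
      have hcard : ∑ _x : Word n q, (1 : ℝ) = q ^ n := by simp
      rw [hcard, ← hM'] at h0
      obtain ⟨⟨c, hc, -⟩, -⟩ := hC
      have hpos : (0 : ℝ) < C.ncard := by
        exact_mod_cast (Set.ncard_pos (Set.toFinite C)).mpr ⟨c, hc⟩
      nlinarith [mul_pos hpos (show (0 : ℝ) < q - 1 by linarith)]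

end Codes

/-! ### Divisibility and size from 1-perfect codes -/

section Perfect

variable {n q : ℕ}

theorem hammingAdj_indicator_perfect {P : Set (Word n q)} (hP : IsOnePerfect P) :
    P.indicator 1 + hammingAdj n q (P.indicator 1) = 1 := by
  ext x
  obtain ⟨c, ⟨hc, hxc⟩, huniq⟩ := hP x
  simp only [Pi.add_apply, Pi.one_apply, hammingAdj_apply]
  by_cases hx : x ∈ P
  · have hcx : x = c := huniq x ⟨hx, by simp⟩
    rw [Set.indicator_of_mem hx, Finset.sum_eq_zero, add_zero, Pi.one_apply]
    intro y hy
    simp only [Finset.mem_filter, Finset.mem_univ, true_and] at hy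
    refine Set.indicator_of_notMem (fun hyP => ?_) _
    have : y = x := (huniq y ⟨hyP, hy.le⟩).trans hcx.symm
    subst this
    simp at hy
  · have hxc1 : hammingDist x c = 1 := by
      have : hammingDist x c ≠ 0 := fun h => hx (hammingDist_eq_zero.mp h ▸ hc)
      omega
    rw [Set.indicator_of_notMem hx, Finset.sum_eq_single_of_mem c (by simpa using hxc1),
      Set.indicator_of_mem hc, Pi.one_apply, zero_add]
    intro y hy hyc
    simp only [Finset.mem_filter, Finset.mem_univ, true_and] at hy
    exact Set.indicator_of_notMem (fun hyP => hyc (huniq y ⟨hyP, hy.le⟩)) _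

/-- Lloyd's condition for `1`-perfect codes. -/
theorem dvd_of_isOnePerfect {P : Set (Word (n + 1) q)} (hP : IsOnePerfect P) (hq : 2 ≤ q) :
    q ∣ n := by
  have hq0 : q ≠ 0 := by omega
  have hq2 : (2 : ℝ) ≤ q := by exact_mod_cast hq
  have hn0 : (0 : ℝ) ≤ n := n.cast_nonneg
  set l : ℝ := (n + 1) * (q - 1) with hl
  have hlpos : 0 < l := mul_pos (by linarith) (by linarith)
  obtain ⟨f, hf⟩ : ∃ f : Word (n + 1) q → ℝ, f = P.indicator 1 := ⟨_, rfl⟩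
  have hfA := hammingAdj_indicator_perfect hP
  rw [← hf] at hfA
  obtain ⟨g, hg⟩ : ∃ g, g = f - (1 + l)⁻¹ • 1 := ⟨_, rfl⟩
  have hAg : hammingAdj (n + 1) q g = -g := by
    have h1 : hammingAdj (n + 1) q 1 = l • 1 := by rw [hammingAdj_one]; push_cast; rfl
    rw [hg, map_sub, map_smul, h1, smul_smul, eq_sub_of_add_eq' hfA]
    have : (1 + l)⁻¹ * l = 1 - (1 + l)⁻¹ := by field_simp; ring
    rw [this, sub_smul, one_smul]
    abel
  -- The values of `f` are 0 and 1, while the subtracted density lies strictly between them.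
  have hg0 : g ≠ 0 := by
    intro h
    have h1 := congrFun h fun _ => ⟨0, by omega⟩
    simp only [hg, Pi.sub_apply, Pi.smul_apply, Pi.one_apply, Pi.zero_apply, smul_eq_mul,
      mul_one, hf] at h1
    have hpos : 0 < (1 + l)⁻¹ := by positivity
    have hlt : (1 + l)⁻¹ < 1 := inv_lt_one_of_one_lt₀ (by linarith)
    rcases Set.indicator_eq_zero_or_self P (1 : Word (n + 1) q → ℝ) fun _ => ⟨0, by omega⟩
      with h2 | h2 <;> rw [h2] at h1
    · linarith
    · rw [Pi.one_apply] at h1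
      linarith
  have hqr : (q : ℝ) ≠ 0 := by exact_mod_cast hq0
  -- In length `n + 1`, the eigenvalue `-1 = qs - (n + 1)` of the adjacency operator corresponds to
  -- `s = n / q`, which must be an integer.
  have hS : ∑ i, coordAvg i g = ((n : ℝ) / q) • g := by
    have h1 := hammingAdj_eq_sum_coordAvg hq0 g
    rw [hAg, eq_comm, sub_eq_iff_eq_add] at h1
    have h2 := congrArg (fun v => (q : ℝ)⁻¹ • v) h1
    simp only [smul_smul, inv_mul_cancel₀ hqr, one_smul] at h2
    rw [h2]
    push_cast
    ext x
    simp only [Pi.smul_apply, Pi.add_apply, Pi.neg_apply, smul_eq_mul]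
    ring
  obtain ⟨k, hk⟩ := eigenvalue_sum_commuting_idempotents coordAvg
    (coordAvg_coordAvg_self hq0) coordAvg_comm Finset.univ _ g hg0 hS
  rw [div_eq_iff hqr] at hk
  have : (n : ℤ) = q * k := by rw [mul_comm]; exact_mod_cast hk
  exact Int.natCast_dvd_natCast.mp ⟨k, this⟩

/-- The size of a shortened `1`-perfect code. -/
theorem ncard_shorten_of_isOnePerfect {P : Set (Word (n + 1) q)} (hP : IsOnePerfect P)
    (hq : 2 ≤ q) (hn : 1 ≤ n) (j : Fin (n + 1)) (a : Fin q) :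
    (shorten P j a).ncard * (n * (q - 1) + q) = q ^ n := by
  classical
  have hq2 : (2 : ℝ) ≤ q := by exact_mod_cast hq
  have hn1 : (1 : ℝ) ≤ n := by exact_mod_cast hn
  obtain ⟨f, hf⟩ : ∃ f : Word (n + 1) q → ℝ, f = P.indicator 1 := ⟨_, rfl⟩
  have hfA := hammingAdj_indicator_perfect hP
  rw [← hf] at hfA
  obtain ⟨t, ht⟩ : ∃ t : Word (n + 1) q → ℝ, t = fun x => if x j = a then 1 else 0 := ⟨_, rfl⟩
  have hJt : coordSum j t = 1 := by
    ext x
    simp [coordSum_apply, ht]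
  have hJt' (i) (hi : i ≠ j) : coordSum i t = (q : ℝ) • t := by
    ext x
    simp [coordSum_apply, ht, Function.update_of_ne hi.symm]
  have hAt : hammingAdj (n + 1) q t = 1 + ((n : ℝ) * (q - 1) - 1) • t := by
    rw [hammingAdj_eq_sum_coordSum, ← Finset.add_sum_erase _ _ (Finset.mem_univ j), hJt,
      Finset.sum_congr rfl fun i hi => hJt' i (Finset.ne_of_mem_erase hi), Finset.sum_const,
      Finset.card_erase_of_mem (Finset.mem_univ _), Finset.card_univ, Fintype.card_fin]
    ext x
    simp
    ring
  have h11 : (1 : Word (n + 1) q → ℝ) ⬝ᵥ 1 = q ^ (n + 1) := by simp [dotProduct]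
  have ht1 : q * (t ⬝ᵥ 1) = (q : ℝ) ^ (n + 1) := by
    rw [← h11]
    nth_rw 2 [← hJt]
    rw [coordSum_dotProduct]
    have : coordSum j (1 : Word (n + 1) q → ℝ) = (q : ℝ) • 1 := by
      ext x
      simp [coordSum_apply]
    rw [this, dotProduct_smul, smul_eq_mul]
  have ht1' : t ⬝ᵥ 1 = (q : ℝ) ^ n := by
    rw [pow_succ', mul_right_inj' (by linarith)] at ht1
    exact ht1
  have htf : t ⬝ᵥ f = (shorten P j a).ncard := by
    have hinj : Function.Injective fun x : Word n q => (j.insertNth a x : Word (n + 1) q) :=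
      Fin.insertNth_right_injective (α := fun _ => Fin q) a
    rw [← Set.ncard_image_of_injective _ hinj]
    have himg : (fun x : Word n q => (j.insertNth a x : Word (n + 1) q)) '' shorten P j a
        = {y | y ∈ P ∧ y ∈ Finset.univ.filter fun y : Word (n + 1) q => y j = a} := by
      ext y
      simp only [Set.mem_image, shorten, Set.mem_ofPred_eq, Finset.mem_filter, Finset.mem_univ,
        true_and]
      constructor
      · rintro ⟨x, hx, rfl⟩
        exact ⟨hx, by simp⟩
      · rintro ⟨hy, rfl⟩
        exact ⟨j.removeNth y, by simpa using hy, by simp⟩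
    rw [himg, ← sum_indicator_one_eq_ncard, Finset.sum_filter, ← hf]
    simp [dotProduct, ht]
  have h1 : f ⬝ᵥ 1 + (n + 1) * (q - 1) * (f ⬝ᵥ 1) = q ^ (n + 1) := by
    have h := congrArg (· ⬝ᵥ (1 : Word (n + 1) q → ℝ)) hfA
    simp only [h11, dotProduct_one, Pi.add_apply, Finset.sum_add_distrib, sum_hammingAdj] at h
    push_cast at h
    rw [dotProduct_one, h]
  have h2 : t ⬝ᵥ f + (f ⬝ᵥ 1 + (n * (q - 1) - 1) * (t ⬝ᵥ f)) = q ^ n := by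
    have h := congrArg (t ⬝ᵥ ·) hfA
    simp only [dotProduct_add, ← hammingAdj_dotProduct, hAt, add_dotProduct, smul_dotProduct,
      smul_eq_mul, ht1', dotProduct_comm 1 f] at h
    exact h
  rw [htf] at h2
  have hl : (0 : ℝ) < n * (q - 1) := mul_pos (by linarith) (by linarith)
  have h3 : ((shorten P j a).ncard : ℝ) * (n * (q - 1) + q) = q ^ n := by
    refine mul_left_cancel₀ hl.ne' ?_
    rw [pow_succ'] at h1
    -- `h1` reads `(l + q)|P| = q^(n+1)` and `h2` reads `|P| + l·(t ⬝ᵥ f) = q^n`, with `l = n(q-1)`;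
    -- eliminate `|P|` and cancel `l`, nonzero since `n ≥ 1`.
    linear_combination (n * (q - 1) + q : ℝ) * h2 - h1
  have : (((shorten P j a).ncard * (n * (q - 1) + q) : ℕ) : ℝ) = ((q ^ n : ℕ) : ℝ) := by
    push_cast [Nat.cast_sub (show 1 ≤ q by omega)]
    exact h3
  exact_mod_cast this

end Perfect

theorem mainTheorem7 (n q : ℕ) (C : Set (Word n q)) (hC : IsShortenedOnePerfectLike C) :
    IsCompletelyRegular C ∧ IsUniformlyPacked C := by
  obtain ⟨M, hM, rfl, hdist⟩ := hC
  obtain ⟨x, -, y, -, hxy, h3⟩ := hdist.1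
  have hn : 3 ≤ n := by
    have := hammingDist_le_card_fintype (x := x) (y := y)
    rw [Fintype.card_fin] at this
    omega
  have hq : 2 ≤ q := by
    obtain ⟨i, hi⟩ := Function.ne_iff.mp hxy
    have := (x i).isLt
    have := (y i).isLt
    have : (x i : ℕ) ≠ y i := fun h => hi (Fin.ext h)
    omega
  rcases hM with ⟨m, hm, hnm, hMm⟩ | ⟨P, hP, j, a, hPM⟩
  · refine isCompletelyRegular_isUniformlyPacked hdist hq (by omega) ?_ (hnm ▸ hMm)
    have h1 : q ∣ n * (q - 1) + q := hnm ▸ dvd_pow_self q (by omega)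
    have h2 : q ∣ n * (q - 1) := (Nat.dvd_add_left dvd_rfl).mp h1
    -- `q` divides `n(q-1)` and is coprime to `q - 1`, hence divides `n`.
    have h3 : q.Coprime (q - 1) :=
      (Nat.coprime_self_sub_right (by omega)).mpr (Nat.coprime_one_right q)
    exact h3.dvd_of_dvd_mul_right h2
  · exact isCompletelyRegular_isUniformlyPacked hdist hq (by omega) (dvd_of_isOnePerfect hP hq)
      (hPM ▸ ncard_shorten_of_isOnePerfect hP hq (by omega) j a)
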